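/- Let $(X,\|\cdot\|)$ be a real or complex Banach space with dual $X'$. The dual Mackey topology $\mu(X',X)$ is the locally convex topology on $X'$ generated by the seminorms $p_K(y)=\sup_{x\in K}|y(x)|$, where $K$ runs through the $\sigma(X,X')$-compact absolutely convex subsets of $X$. Let $(T(t))_{t\ge 0}$ be a $\mu(X',X)$-bi-continuous semigroup on $X'$, i.e. a family of norm-continuous linear operators on $X'$ such that: $T(0)=\mathrm{id}$ and $T(t+s)=T(t)T(s)$ for all $t,s\ge 0$; $t\mapsto T(t)y$ is $\mu(X',X)$-continuous on $[0,\infty)$ for every $y\in X'$; there are $M\ge 1$ and $\omega\in\mathbb{R}$ with $\|T(t)\|\le Me^{\omega t}$ for all $t\ge 0$; and whenever $(y_n)_{n\in\mathbb{N}}$ is a norm-bounded sequence in $X'$ that converges to $y$ for $\mu(X',X)$, then $T(t)(y_n-y)\to 0$ for $\mu(X',X)$, uniformly for $t\in[0,t_0]$, for every $t_0\ge 0$. Terminology. $X$ is SWCG (strongly weakly compactly generated) if there is a $\sigma(X,X')$-compact set $K\subset X$ such that for every $\sigma(X,X')$-compact set $L\subset X$ and every $\varepsilon>0$ there is $n\in\mathbb{N}$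 with $L\subset nK+\varepsilon\{x\in X : \|x\|\le 1\}$. $X$ is weakly sequentially complete if every $\sigma(X,X')$-Cauchy sequence in $X$ is $\sigma(X,X')$-convergent. $X$ has an almost shrinking basis if it has a Schauder basis whose sequence of coefficient functionals is a Schauder basis of $(X',\mu(X',X))$. $X$ is a Schur space if every $\sigma(X,X')$-convergent sequence in $X$ is norm convergent. The semigroup $(T(t))_{t\ge 0}$ is quasi-$\mu(X',X)$-equicontinuous if for some $\alpha\in\mathbb{R}$ the family $(e^{-\alpha t}T(t))_{t\ge 0}$ is $\mu(X',X)$-equicontinuous. It is quasi-$(\|\cdot\|_{X'},\mu(X',X))$-equitight if for some $\alpha\in\mathbb{R}$ the following holds: for every $\varepsilon>0$ and every $\sigma(X,X')$-compact absolutely convex $K\subset X$ there are a $\sigma(X,X')$-compact absolutely convex $\widetilde K\subset X$ and $C\ge 0$ such that $p_K(e^{-\alpha t}T(t)y)\le C\,p_{\widetilde K}(y)+\varepsilon\|y\|_{X'}$ for all $t\ge 0$ and $y\in X'$. Theorem. (a) If $X$ is SWCG, or if $X$ is weakly sequentially complete and has an almost shrinking basis, then $(T(t))_{t\ge 0}$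 is quasi-$\mu(X',X)$-equicontinuous. (b) If $X$ is an SWCG Schur space, then $(T(t))_{t\ge 0}$ is quasi-$\mu(X',X)$-equicontinuous and quasi-$(\|\cdot\|_{X'},\mu(X',X))$-equitight. In particular, this applies if $X$ is a separable Schur space, since every separable Schur space is SWCG. -/

import Mathlib

open Filter Topology
open scoped NNReal Pointwise ComplexOrder

/-! ### Weak compactness and classes of Banach spaces -/

/-- `K` is `σ(X, X')`-compact. -/
def IsWeaklyCompact (𝕜 : Type*) {X : Type*} [RCLike 𝕜] [NormedAddCommGroup X] [NormedSpace 𝕜 X]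
    (K : Set X) : Prop :=
  IsCompact (toWeakSpace 𝕜 X '' K)

/-- Strongly weakly compactly generated spaces. -/
def IsSWCG (𝕜 X : Type*) [RCLike 𝕜] [NormedAddCommGroup X] [NormedSpace 𝕜 X] : Prop :=
  ∃ K : Set X, IsWeaklyCompact 𝕜 K ∧
    ∀ L : Set X, IsWeaklyCompact 𝕜 L → ∀ ε : ℝ, 0 < ε →
      ∃ n : ℕ, L ⊆ (n : 𝕜) • K + Metric.closedBall (0 : X) ε

/-- Schur spaces: weakly convergent sequences converge in norm. -/
def IsSchurSpace (𝕜 X : Type*) [RCLike 𝕜] [NormedAddCommGroup X] [NormedSpace 𝕜 X] : Prop :=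
  ∀ (x : ℕ → X) (l : X),
    Tendsto (fun n => toWeakSpace 𝕜 X (x n)) atTop (𝓝 (toWeakSpace 𝕜 X l)) →
      Tendsto x atTop (𝓝 l)

/-- Weak sequential completeness: weakly Cauchy sequences converge weakly. (A sequence is
Cauchy for `σ(X, X')` iff its image under every `f ∈ X'` is a Cauchy sequence of scalars.) -/
def IsWeaklySeqComplete (𝕜 X : Type*) [RCLike 𝕜] [NormedAddCommGroup X] [NormedSpace 𝕜 X] :
    Prop :=
  ∀ x : ℕ → X, (∀ f : StrongDual 𝕜 X, CauchySeq fun n => f (x n)) →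
    ∃ l : X, Tendsto (fun n => toWeakSpace 𝕜 X (x n)) atTop (𝓝 (toWeakSpace 𝕜 X l))

/-! ### The dual Mackey topology `μ(X', X)` -/

/-- The `σ(X, X')`-compact absolutely convex subsets of `X`. -/
def WeaklyCompactAbsConvex (𝕜 X : Type*) [RCLike 𝕜] [NormedAddCommGroup X] [NormedSpace 𝕜 X] :
    Type _ :=
  {K : Set X // IsWeaklyCompact 𝕜 K ∧ AbsConvex 𝕜 K}

instance (𝕜 X : Type*) [RCLike 𝕜] [NormedAddCommGroup X] [NormedSpace 𝕜 X] :
    Nonempty (WeaklyCompactAbsConvex 𝕜 X) :=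
  ⟨⟨∅, by simp [IsWeaklyCompact], AbsConvex.empty⟩⟩

theorem IsWeaklyCompact.bddAbove_norm_apply {𝕜 X : Type*} [RCLike 𝕜] [NormedAddCommGroup X]
    [NormedSpace 𝕜 X] {K : Set X} (hK : IsWeaklyCompact 𝕜 K) (y : StrongDual 𝕜 X) :
    BddAbove (Set.range fun x : K => ‖y x‖) := by
  have hc : Continuous fun z : WeakSpace 𝕜 X => y ((toWeakSpace 𝕜 X).symm z) :=
    WeakBilin.eval_continuous (topDualPairing 𝕜 X).flip y
  refine (hK.bddAbove_image hc.norm.continuousOn).mono ?_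
  rintro _ ⟨x, rfl⟩
  exact ⟨toWeakSpace 𝕜 X x, ⟨x, x.2, rfl⟩, by simp⟩

/-- The seminorm `p_K(y) = sup_{x ∈ K} |y(x)|` on `X'`. -/
noncomputable def dualMackeySeminorm (𝕜 X : Type*) [RCLike 𝕜] [NormedAddCommGroup X]
    [NormedSpace 𝕜 X] (K : WeaklyCompactAbsConvex 𝕜 X) : Seminorm 𝕜 (StrongDual 𝕜 X) :=
  Seminorm.of (fun y => ⨆ x : K.1, ‖y x‖)
    (fun y z => by
      have hy := K.2.1.bddAbove_norm_apply y
      have hz := K.2.1.bddAbove_norm_apply z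
      refine Real.iSup_le (fun x => ?_) (add_nonneg (Real.iSup_nonneg fun _ => norm_nonneg _)
        (Real.iSup_nonneg fun _ => norm_nonneg _))
      exact (norm_add_le (y x) (z x)).trans (add_le_add (le_ciSup hy x) (le_ciSup hz x)))
    (fun a y => by
      simp only [smul_apply, norm_smul]
      exact (Real.mul_iSup_of_nonneg (norm_nonneg a) _).symm)

/-- The dual Mackey topology `μ(X', X)`: the locally convex topology on `X'` generated by the
seminorms `p_K`, `K` running through the `σ(X, X')`-compact absolutely convex subsets of `X`. -/
@[reducible]
noncomputable def dualMackeyTopology (𝕜 X : Type*) [RCLike 𝕜] [NormedAddCommGroup X]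
    [NormedSpace 𝕜 X] : TopologicalSpace (StrongDual 𝕜 X) :=
  SeminormFamily.moduleFilterBasis (𝕜 := 𝕜) (dualMackeySeminorm 𝕜 X) |>.topology

/-! ### Almost shrinking bases -/

/-- `(f n)` is a Schauder basis of `(E, τ)`: every `y ∈ E` has exactly one expansion
`y = ∑ a n • f n` with respect to `τ`, and its coefficients `a n = c n y` depend linearly and
`τ`-continuously on `y`. -/
def IsSchauderBasisFor (𝕜 : Type*) {E : Type*} [RCLike 𝕜] [AddCommGroup E] [Module 𝕜 E]
    (τ : TopologicalSpace E) (f : ℕ → E) : Prop :=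
  ∃ c : ℕ → E →ₗ[𝕜] 𝕜, (∀ n, Continuous[τ, inferInstance] (c n)) ∧
    ∀ (y : E) (a : ℕ → 𝕜),
      Tendsto (fun N => ∑ n ∈ Finset.range N, a n • f n) atTop (@nhds E τ y) ↔
        ∀ n, a n = c n y

/-- `X` has an almost shrinking basis: a Schauder basis whose coefficient functionals form a
Schauder basis of `(X', μ(X', X))`. -/
def HasAlmostShrinkingBasis (𝕜 X : Type*) [RCLike 𝕜] [NormedAddCommGroup X] [NormedSpace 𝕜 X] :
    Prop :=
  ∃ b : SchauderBasis 𝕜 X, IsSchauderBasisFor 𝕜 (dualMackeyTopology 𝕜 X) b.coord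

/-! ### Bi-continuous semigroups, equicontinuity, equitightness -/

section Semigroups

variable {𝕜 E : Type*} [RCLike 𝕜] [NormedAddCommGroup E] [NormedSpace 𝕜 E]

/-! In this section `E →L[𝕜] E` always consists of the operators that are continuous for the norm
of `E`; the second topology `τ` is bound after the operators. -/

/-- `τ`-bi-continuous semigroups of bounded operators on the normed space `E`. -/
structure IsBiContinuousSemigroup (T : ℝ≥0 → E →L[𝕜] E) (τ : TopologicalSpace E) : Prop where
  map_zero : ∀ x, T 0 x = x
  map_add : ∀ t s x, T (t + s) x = T t (T s x)
  /-- `τ`-strong continuity. -/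
  continuous_orbit : ∀ x : E, Continuous[inferInstance, τ] fun t => T t x
  /-- Exponential boundedness. -/
  exp_bounded : ∃ M : ℝ, 1 ≤ M ∧ ∃ ω : ℝ, ∀ t : ℝ≥0, ‖T t‖ ≤ M * Real.exp (ω * t)
  /-- Local bi-equicontinuity: if `(x n)` is norm bounded and `τ`-convergent to `x`, then
  `T t (x n - x) → 0` for `τ`, uniformly for `t` in every `[0, t₀]`. -/
  locally_biequicontinuous : ∀ (x : ℕ → E) (l : E), (∃ C : ℝ, ∀ n, ‖x n‖ ≤ C) →
    Tendsto x atTop (@nhds E τ l) →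
      ∀ t₀ : ℝ≥0, ∀ U ∈ @nhds E τ 0, ∀ᶠ n in atTop, ∀ t ≤ t₀, T t (x n - l) ∈ U

/-- `τ`-equicontinuity of a family of operators. -/
def IsTauEquicontinuous {I : Type*} (S : I → E →L[𝕜] E) (τ : TopologicalSpace E) : Prop :=
  ∀ x : E, ∀ U ∈ @nhds E τ 0, ∃ V ∈ @nhds E τ x, ∀ t, ∀ y ∈ V, S t y - S t x ∈ U

/-- Equitightness of a family of operators on `E` with respect to the norm of `E` and the
topology generated by the directed system of seminorms `p`. -/
def IsEquitight {I ι : Type*} (p : ι → Seminorm 𝕜 E) (S : I → E →L[𝕜] E) : Prop :=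
  ∀ ε : ℝ, 0 < ε → ∀ i, ∃ j, ∃ C : ℝ, 0 ≤ C ∧ ∀ t x, p i (S t x) ≤ C * p j x + ε * ‖x‖

/-- The rescaled family `(e^{-αt} T(t))_{t ≥ 0}`. -/
noncomputable def rescale (α : ℝ) (T : ℝ≥0 → E →L[𝕜] E) (t : ℝ≥0) : E →L[𝕜] E :=
  ((Real.exp (-α * t) : ℝ) : 𝕜) • T t

/-- Quasi-`τ`-equicontinuity. -/
def IsQuasiEquicontinuous (T : ℝ≥0 → E →L[𝕜] E) (τ : TopologicalSpace E) : Prop :=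
  ∃ α : ℝ, IsTauEquicontinuous (rescale α T) τ

/-- Quasi-equitightness. -/
def IsQuasiEquitight {ι : Type*} (p : ι → Seminorm 𝕜 E) (T : ℝ≥0 → E →L[𝕜] E) : Prop :=
  ∃ α : ℝ, IsEquitight p (rescale α T)

end Semigroups

/-! ### Interchange of limits -/

/-- Along a sequence of finitely supported probability measures on a compact set, a bounded
sequence of continuous functions that converges pointwise to zero has small integrals for
infinitely many of the measures. -/
theorem eventually_frequently_sum_lt_of_pointwise_tendsto {Z ι : Type*} [TopologicalSpace Z]
    [T2Space Z] {S : Set Z} (hS : IsCompact S) (s : ℕ → Finset ι) (w : ℕ → ι → ℝ) (pt : ι → Z)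
    (hw : ∀ n, ∀ j ∈ s n, 0 ≤ w n j) (hw1 : ∀ n, ∑ j ∈ s n, w n j = 1)
    (hpt : ∀ n, ∀ j ∈ s n, pt j ∈ S) (g : ℕ → Z → ℝ) (hg : ∀ i, Continuous (g i)) {B : ℝ}
    (hB : ∀ i, ∀ z ∈ S, |g i z| ≤ B) (hlim : ∀ z ∈ S, Tendsto (fun i => g i z) atTop (𝓝 0))
    {ε : ℝ} (hε : 0 < ε) :
    ∀ᶠ i in atTop, ∃ᶠ n in atTop, ∑ j ∈ s n, w n j * g i (pt j) < ε := by
  classical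
  have : CompactSpace S := isCompact_iff_compactSpace.mp hS
  let _ : MeasurableSpace S := borel S
  have : BorelSpace S := ⟨rfl⟩
  set F : C(S, ℝ) → Z → ℝ := fun f z => if h : z ∈ S then f ⟨z, h⟩ else 0 with hF
  set I : ℕ → C(S, ℝ) → ℝ := fun n f => ∑ j ∈ s n, w n j * F f (pt j) with hI
  have hFle : ∀ f z, |F f z| ≤ ‖f‖ := by
    intro f z
    simp only [hF]
    split_ifs with h
    · exact f.norm_coe_le_norm ⟨z, h⟩
    · simp
  have hIle : ∀ n f, I n f ∈ Set.Icc (-‖f‖) ‖f‖ := by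
    intro n f
    rw [Set.mem_Icc, ← abs_le]
    calc |I n f| ≤ ∑ j ∈ s n, |w n j * F f (pt j)| := Finset.abs_sum_le_sum_abs _ _
      _ ≤ ∑ j ∈ s n, w n j * ‖f‖ := Finset.sum_le_sum fun j hj => by
          rw [abs_mul, abs_of_nonneg (hw n j hj)]
          exact mul_le_mul_of_nonneg_left (hFle f _) (hw n j hj)
      _ = ‖f‖ := by rw [← Finset.sum_mul, hw1, one_mul]
  set U : Ultrafilter ℕ := hyperfilter ℕ with hU
  have hex : ∀ f, ∃ l, Tendsto (fun n => I n f) U (𝓝 l) := by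
    intro f
    obtain ⟨l, -, hl⟩ := (isCompact_Icc (a := -‖f‖) (b := ‖f‖)).ultrafilter_le_nhds
      (U.map fun n => I n f) (by
        rw [le_principal_iff]
        exact Filter.mem_map.mpr (Filter.univ_mem' fun n => hIle n f))
    exact ⟨l, hl⟩
  choose Λ hΛ using hex
  have hadd : ∀ f f', Λ (f + f') = Λ f + Λ f' := fun f f' => by
    refine tendsto_nhds_unique (hΛ (f + f')) (((hΛ f).add (hΛ f')).congr fun n => ?_)
    simp only [hI, ← Finset.sum_add_distrib, ← mul_add]
    refine Finset.sum_congr rfl fun j _ => ?_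
    simp only [hF]
    split_ifs <;> simp
  have hsmul : ∀ (c : ℝ) f, Λ (c • f) = c * Λ f := fun c f => by
    refine tendsto_nhds_unique (hΛ (c • f)) (((hΛ f).const_mul c).congr fun n => ?_)
    simp only [hI, Finset.mul_sum]
    refine Finset.sum_congr rfl fun j _ => ?_
    simp only [hF]
    split_ifs
    · simp; ring
    · simp
  have hmono : ∀ f f' : C(S, ℝ), f ≤ f' → Λ f ≤ Λ f' := fun f f' h => by
    refine le_of_tendsto_of_tendsto' (hΛ f) (hΛ f') fun n => ?_
    refine Finset.sum_le_sum fun j hj => mul_le_mul_of_nonneg_left ?_ (hw n j hj)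
    simp only [hF]
    split_ifs with hz
    · exact h _
    · rfl
  let Λ' : CompactlySupportedContinuousMap S ℝ →ₚ[ℝ] ℝ :=
    { toFun f := Λ f.toContinuousMap
      map_add' f f' := hadd _ _
      map_smul' c f := hsmul c _
      monotone' f f' h := hmono _ _ h }
  let ν := RealRMK.rieszMeasure Λ'
  let G : ℕ → CompactlySupportedContinuousMap S ℝ := fun i =>
    ⟨⟨fun z => g i z, (hg i).comp continuous_subtype_val⟩, HasCompactSupport.of_compactSpace _⟩
  have hGint : Tendsto (fun i => ∫ z, G i z ∂ν) atTop (𝓝 (∫ _, (0 : ℝ) ∂ν)) := by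
    refine MeasureTheory.tendsto_integral_of_dominated_convergence (fun _ => B)
      (fun i => (G i).continuous.aestronglyMeasurable) (MeasureTheory.integrable_const B)
      (fun i => MeasureTheory.ae_of_all _ fun z => hB i z z.2) (MeasureTheory.ae_of_all _ fun z => hlim z z.2)
  rw [MeasureTheory.integral_zero] at hGint
  filter_upwards [hGint.eventually_lt_const hε] with i hi
  have hi' : Λ (G i).toContinuousMap < ε := by
    rw [RealRMK.integral_rieszMeasure] at hi
    exact hi
  have hev : ∀ᶠ n in (U : Filter ℕ), I n (G i).toContinuousMap < ε :=
    (hΛ _).eventually_lt_const hi'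
  have hfreq : ∃ᶠ n in atTop, I n (G i).toContinuousMap < ε :=
    hev.frequently.filter_mono (Nat.hyperfilter_le_atTop)
  refine hfreq.mono fun n hn => lt_of_eq_of_lt (Finset.sum_congr rfl fun j hj => ?_) hn
  simp only [hF, dif_pos (hpt n j hj)]
  rfl

/-! ### Functionals on the dual that are dominated by weakly compact sets -/

section Representation

variable {𝕜 X : Type*} [RCLike 𝕜] [NormedAddCommGroup X] [NormedSpace 𝕜 X]

/-- Helly-type lemma: a functional on `X'` at distance `≥ d` from `X` is large on the annihilator
of every finite subset of `X`. -/
theorem exists_dual_eq_zero_on_finset (φ : StrongDual 𝕜 (StrongDual 𝕜 X)) {d : ℝ} (hd : 0 < d)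
    (hφ : ∀ x, d ≤ ‖φ - NormedSpace.inclusionInDoubleDual 𝕜 X x‖) (s : Finset X) :
    ∃ y : StrongDual 𝕜 X, ‖y‖ ≤ 1 ∧ (∀ x ∈ s, y x = 0) ∧ d / 2 ≤ ‖φ y‖ := by
  by_contra! hcon
  let ev : s → StrongDual 𝕜 X →ₗ[𝕜] 𝕜 := fun x =>
    (NormedSpace.inclusionInDoubleDual 𝕜 X x).toLinearMap
  let N : Submodule 𝕜 (StrongDual 𝕜 X) := ⨅ x, LinearMap.ker (ev x)
  have hN : ∀ y, y ∈ N ↔ ∀ x ∈ s, y x = 0 := by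
    intro y
    simp [N, ev]
  have hbound : ∀ y ∈ N, ‖φ y‖ ≤ d / 2 * ‖y‖ := by
    intro y hy
    rcases eq_or_ne y 0 with rfl | hy0
    · simp
    have hy' : ‖y‖ ≠ 0 := norm_ne_zero_iff.mpr hy0
    have h1 := hcon (((‖y‖⁻¹ : ℝ) : 𝕜) • y) (by
      rw [norm_smul, RCLike.norm_ofReal, abs_inv, abs_norm, inv_mul_cancel₀ hy'])
      (fun x hx => by simp [(hN y).1 hy x hx])
    rw [map_smul, norm_smul, RCLike.norm_ofReal, abs_inv, abs_norm,
      inv_mul_lt_iff₀ (norm_pos_iff.mpr hy0)] at h1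
    linarith
  let p : Seminorm 𝕜 (StrongDual 𝕜 X) := (d / 2).toNNReal •
    normSeminorm 𝕜 (StrongDual 𝕜 X)
  have hp : ∀ y, p y = d / 2 * ‖y‖ := fun y => by
    simp only [p, _root_.smul_apply, NNReal.smul_def, coe_normSeminorm, smul_eq_mul]
    rw [Real.coe_toNNReal _ (by positivity)]
  obtain ⟨g, hg, hgp⟩ := Module.Dual.exists_extension_of_le_seminorm N
    (φ.toLinearMap.comp N.subtype) (p := p) (fun y => by
      rw [hp]; exact hbound y y.2)
  have hker : N ≤ LinearMap.ker (φ.toLinearMap - g) := fun y hy => by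
    have := hg ⟨y, hy⟩
    simp only [LinearMap.comp_apply, Submodule.subtype_apply] at this
    rw [LinearMap.mem_ker, LinearMap.sub_apply, this, sub_self]
  obtain ⟨c, hc⟩ := (Submodule.mem_span_range_iff_exists_fun 𝕜).1
    (mem_span_of_iInf_ker_le_ker hker)
  set x₀ : X := ∑ x : s, c x • (x : X) with hx₀
  have hrep : ∀ y, φ y - y x₀ = g y := fun y => by
    have h := congrArg (fun L : StrongDual 𝕜 X →ₗ[𝕜] 𝕜 => L y) hc
    simp only [LinearMap.sum_apply, LinearMap.smul_apply, LinearMap.sub_apply, ev] at h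
    have h2 : y x₀ = φ y - g y := by
      rw [hx₀, map_sum]
      simpa using h
    rw [h2]; ring
  have hle : ‖φ - NormedSpace.inclusionInDoubleDual 𝕜 X x₀‖ ≤ d / 2 := by
    refine ContinuousLinearMap.opNorm_le_bound _ (by positivity) fun y => ?_
    have := hgp y
    rw [hp, ← hrep] at this
    simpa using this
  linarith [hφ x₀]

theorem re_apply_le_of_forall_closedBall (y : StrongDual 𝕜 X) {ε v : ℝ} (hε : 0 ≤ ε)
    (h : ∀ e : X, ‖e‖ ≤ ε → RCLike.re (y e) ≤ v) : ε * ‖y‖ ≤ v := by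
  have hv : 0 ≤ v := by simpa using h 0 (by simpa using hε)
  rcases hε.eq_or_lt with rfl | hε
  · simpa using hv
  rw [← le_div_iff₀' hε]
  refine ContinuousLinearMap.opNorm_le_bound _ (by positivity) fun x => ?_
  rcases eq_or_ne x 0 with rfl | hx
  · simp
  rcases eq_or_ne (y x) 0 with hyx | hyx
  · rw [hyx, norm_zero]; positivity
  have hx' : ‖x‖ ≠ 0 := norm_ne_zero_iff.mpr hx
  have hyx' : ‖y x‖ ≠ 0 := norm_ne_zero_iff.mpr hyx
  have hn : ‖starRingEnd 𝕜 (y x)‖ = ‖y x‖ := RCLike.norm_conj _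
  have h1 := h (((ε / (‖x‖ * ‖y x‖) : ℝ) : 𝕜) • (starRingEnd 𝕜 (y x)) • x) (by
    rw [norm_smul, norm_smul, hn, RCLike.norm_ofReal, abs_of_pos (by positivity)]
    apply le_of_eq
    field_simp)
  rw [map_smul y, map_smul y, smul_eq_mul, smul_eq_mul, RCLike.re_ofReal_mul, RCLike.conj_mul,
    ← RCLike.ofReal_pow, RCLike.ofReal_re] at h1
  have h2 : ε / (‖x‖ * ‖y x‖) * ‖y x‖ ^ 2 = ε / ‖x‖ * ‖y x‖ := by field_simp
  rw [h2] at h1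
  rw [div_mul_eq_mul_div, le_div_iff₀ hε]
  rw [div_mul_eq_mul_div, div_le_iff₀ (norm_pos_iff.mpr hx)] at h1
  linarith

/-- A functional on `X'` dominated by the support function of `B + ε • ball` is approximated on
finitely many elements of `X'` by elements of `convexHull B + ε • ball`. -/
theorem exists_convexHull_approx (φ : StrongDual 𝕜 (StrongDual 𝕜 X)) {B : Set X} {ε : ℝ}
    (hε : 0 ≤ ε) [Module ℝ X] [IsScalarTower ℝ 𝕜 X]
    (hφ : ∀ (y : StrongDual 𝕜 X) (u : ℝ), (∀ b ∈ B, RCLike.re (y b) ≤ u) →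
      RCLike.re (φ y) ≤ u + ε * ‖y‖)
    (s : Finset (StrongDual 𝕜 X)) {δ : ℝ} (hδ : 0 < δ) :
    ∃ u ∈ convexHull ℝ B, ∃ e : X, ‖e‖ ≤ ε ∧ ∀ y ∈ s, ‖y (u + e) - φ y‖ < δ := by
  classical
  let L : X →ₗ[𝕜] (s → 𝕜) := LinearMap.pi fun y => y.1.toLinearMap
  let v : s → 𝕜 := fun y => φ y
  have hball : Convex ℝ {e : X | ‖e‖ ≤ ε} := by
    intro a ha b hb r t hr ht hrt
    simp only [Set.mem_ofPred_eq] at *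
    have h1 : ∀ (r : ℝ) (a : X), r • a = (r : 𝕜) • a := fun r a => by
      rw [← algebraMap_smul 𝕜 r a]
    rw [h1, h1]
    calc _ ≤ ‖(r : 𝕜) • a‖ + ‖(t : 𝕜) • b‖ := norm_add_le _ _
      _ = r * ‖a‖ + t * ‖b‖ := by
        rw [norm_smul, norm_smul, RCLike.norm_ofReal, RCLike.norm_ofReal, abs_of_nonneg hr,
          abs_of_nonneg ht]
      _ ≤ r * ε + t * ε := by gcongr
      _ = ε := by rw [← add_mul, hrt, one_mul]
  have hA : Convex ℝ (L.restrictScalars ℝ '' (convexHull ℝ B + {e : X | ‖e‖ ≤ ε})) :=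
    ((convex_convexHull ℝ B).add hball).linear_image _
  have hmem : v ∈ closure (L.restrictScalars ℝ '' (convexHull ℝ B + {e : X | ‖e‖ ≤ ε})) := by
    by_contra hv
    obtain ⟨f, u, hfu, hufv⟩ := RCLike.geometric_hahn_banach_closed_point (𝕜 := 𝕜)
      hA.closure isClosed_closure hv
    let y : StrongDual 𝕜 X := ∑ i : s, f (Pi.single i 1) • (i : StrongDual 𝕜 X)
    have hf : ∀ z : s → 𝕜, f z = ∑ i, f (Pi.single i 1) * z i := fun z => by
      conv_lhs => rw [← LinearMap.sum_single_apply (fun _ : s => 𝕜) z, map_sum]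
      refine Finset.sum_congr rfl fun i _ => ?_
      have : Pi.single i (z i) = z i • (Pi.single i (1 : 𝕜) : s → 𝕜) := by
        rw [← Pi.single_smul]; simp
      rw [this, map_smul, smul_eq_mul, mul_comm]
    have hfL : ∀ x, f (L x) = y x := fun x => by
      rw [hf]; simp [y, L]
    have hfv : f v = φ y := by
      rw [hf]; simp [y, v]
    have hlt : ∀ b ∈ B, ∀ e : X, ‖e‖ ≤ ε → RCLike.re (y b) + RCLike.re (y e) ≤ u := by
      intro b hb e he
      have := hfu (L (b + e)) (subset_closure ⟨b + e, Set.add_mem_add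
        (subset_convexHull ℝ B hb) he, rfl⟩)
      rw [hfL, map_add, map_add] at this
      exact this.le
    have h1 := hφ y (u - ε * ‖y‖) fun b hb => by
      have := re_apply_le_of_forall_closedBall y hε (v := u - RCLike.re (y b))
        fun e he => by linarith [hlt b hb e he]
      linarith
    rw [hfv] at hufv
    linarith
  obtain ⟨_, ⟨_, ⟨u, hu, e, he, rfl⟩, rfl⟩, hdist⟩ := Metric.mem_closure_iff.1 hmem δ hδ
  refine ⟨u, hu, e, he, fun y hy => ?_⟩
  have := (dist_pi_lt_iff hδ).1 hdist ⟨y, hy⟩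
  rw [dist_comm, dist_eq_norm] at this
  simpa [L, v] using this

theorem exists_ultrafilter_tendsto_apply {ι : Type*} (V : Ultrafilter ι)
    (y : ι → StrongDual 𝕜 X) {C : ℝ} (hy : ∀ n, ‖y n‖ ≤ C) :
    ∃ l : StrongDual 𝕜 X, ‖l‖ ≤ C ∧ ∀ x, Tendsto (fun n => y n x) V (𝓝 (l x)) := by
  obtain ⟨l, hl, hVl⟩ := (WeakDual.isCompact_closedBall (0 : StrongDual 𝕜 X) C).ultrafilter_le_nhds
    (V.map fun n => StrongDual.toWeakDual (y n)) (by
      rw [le_principal_iff]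
      refine Filter.mem_map.mpr (Filter.univ_mem' fun n => ?_)
      simpa using hy n)
  refine ⟨WeakDual.toStrongDual l, by simpa using hl, fun x => ?_⟩
  exact ((WeakDual.eval_continuous x).tendsto l).comp hVl

theorem weakSpace_apply_continuous (y : StrongDual 𝕜 X) :
    Continuous fun z : WeakSpace 𝕜 X => y ((toWeakSpace 𝕜 X).symm z) :=
  WeakBilin.eval_continuous (topDualPairing 𝕜 X).flip y

instance : T2Space (WeakSpace 𝕜 X) :=
  (NormedSpace.isEmbedding_inclusionInDoubleDualWeak 𝕜 X).t2Space

/-- A bounded sequence of functionals has a subsequence which converges pointwise on the weak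
closure of a given countable set. -/
theorem exists_subseq_tendsto_on_closure (y : ℕ → StrongDual 𝕜 X) {C : ℝ} (hy : ∀ n, ‖y n‖ ≤ C)
    {D : Set X} (hD : D.Countable) :
    ∃ k : ℕ → ℕ, StrictMono k ∧ ∃ l : StrongDual 𝕜 X, ‖l‖ ≤ C ∧
      ∀ z ∈ closure (toWeakSpace 𝕜 X '' D),
        Tendsto (fun i => y (k i) ((toWeakSpace 𝕜 X).symm z)) atTop
          (𝓝 (l ((toWeakSpace 𝕜 X).symm z))) := by
  have : Countable D := hD.to_subtype
  have hcpt : IsCompact (Set.univ.pi fun d : D => Metric.closedBall (0 : 𝕜) (C * ‖(d : X)‖)) :=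
    isCompact_univ_pi fun d => isCompact_closedBall _ _
  obtain ⟨a, -, k, hk, hka⟩ := hcpt.tendsto_subseq (x := fun n (d : D) => y n d) (fun n d _ => by
    simpa using (y n).le_of_opNorm_le (hy n) d)
  rw [tendsto_pi_nhds] at hka
  have key : ∀ V : Ultrafilter ℕ, (V : Filter ℕ) ≤ atTop → ∀ l : StrongDual 𝕜 X,
      (∀ x, Tendsto (fun n => y (k n) x) V (𝓝 (l x))) → ∀ d : D, l d = a d :=
    fun V hV l hl d => tendsto_nhds_unique (hl d) ((hka d).mono_left hV)
  obtain ⟨l, hlC, hl⟩ := exists_ultrafilter_tendsto_apply (hyperfilter ℕ) (fun n => y (k n))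
    fun n => hy _
  refine ⟨k, hk, l, hlC, fun z hz => ?_⟩
  rw [tendsto_iff_ultrafilter]
  intro V hV
  obtain ⟨l', -, hl'⟩ := exists_ultrafilter_tendsto_apply V (fun n => y (k n)) fun n => hy _
  have heq : Set.EqOn (fun z => l ((toWeakSpace 𝕜 X).symm z))
      (fun z => l' ((toWeakSpace 𝕜 X).symm z)) (toWeakSpace 𝕜 X '' D) := by
    rintro _ ⟨d, hd, rfl⟩
    simp only [LinearEquiv.symm_apply_apply]
    exact (key _ Nat.hyperfilter_le_atTop l hl ⟨d, hd⟩).trans (key V hV l' hl' ⟨d, hd⟩).symm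
  have := heq.closure (weakSpace_apply_continuous l) (weakSpace_apply_continuous l') hz
  simp only at this
  rw [this]
  exact hl' _

theorem IsWeaklyCompact.exists_norm_le {K : Set X} (hK : IsWeaklyCompact 𝕜 K) :
    ∃ R : ℝ, 0 ≤ R ∧ ∀ x ∈ K, ‖x‖ ≤ R := by
  obtain ⟨R, hR⟩ := banach_steinhaus
    (g := fun x : K => NormedSpace.inclusionInDoubleDual 𝕜 X x) fun y => by
      obtain ⟨C, hC⟩ := hK.bddAbove_norm_apply y
      exact ⟨C, fun x => by simpa using hC ⟨x, rfl⟩⟩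
  refine ⟨max R 0, le_max_right _ _, fun x hx => le_max_of_le_left ?_⟩
  have := hR ⟨x, hx⟩
  exact ((NormedSpace.inclusionInDoubleDualLi (𝕜 := 𝕜) (E := X)).norm_map x).symm.trans_le this

/-- Krein's theorem in functional form: a functional on `X'` that is, up to `ε • ‖·‖`, dominated
by the support function of a weakly compact set for every `ε > 0` is an evaluation. -/
theorem exists_eq_apply_of_dominated_by_isWeaklyCompact [CompleteSpace X]
    (φ : StrongDual 𝕜 (StrongDual 𝕜 X))
    (hφ : ∀ ε : ℝ, 0 < ε → ∃ B : Set X, IsWeaklyCompact 𝕜 B ∧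
      ∀ (y : StrongDual 𝕜 X) (u : ℝ), (∀ b ∈ B, RCLike.re (y b) ≤ u) →
        RCLike.re (φ y) ≤ u + ε * ‖y‖) :
    ∃ x : X, ∀ y, φ y = y x := by
  classical
  let J := NormedSpace.inclusionInDoubleDualLi (𝕜 := 𝕜) (E := X)
  by_contra hcon
  have hφJ : φ ∉ Set.range J := by
    rintro ⟨x, rfl⟩
    exact hcon ⟨x, fun y => rfl⟩
  have hclosed : IsClosed (Set.range J) := by
    have hJ := J.isometry.isUniformInducing.isComplete_range
    exact hJ.isClosed
  have hd : 0 < Metric.infDist φ (Set.range J) :=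
    (hclosed.notMem_iff_infDist_pos (Set.range_nonempty _)).1 hφJ
  set d := Metric.infDist φ (Set.range J) with hd_def
  have hdist : ∀ x, d ≤ ‖φ - NormedSpace.inclusionInDoubleDual 𝕜 X x‖ := fun x => by
    exact (Metric.infDist_le_dist_of_mem (Set.mem_range_self (f := J) x)).trans_eq
      (dist_eq_norm φ (J x))
  obtain ⟨ε, hε, hεd⟩ : ∃ ε : ℝ, 0 < ε ∧ 8 * ε < d := ⟨d / 9, by positivity, by linarith⟩
  obtain ⟨B, hB, hφB⟩ := hφ ε hε
  let _ : Module ℝ X := .restrictScalars ℝ 𝕜 X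
  have : IsScalarTower ℝ 𝕜 X := .restrictScalars _ _ _
  obtain ⟨f, hfP, hfr⟩ := exists_seq_of_forall_finset_exists
    (fun p : StrongDual 𝕜 X × X × X => ‖p.1‖ ≤ 1 ∧ d / 2 ≤ ‖φ p.1‖ ∧ p.2.1 ∈ convexHull ℝ B ∧
      ‖p.2.2‖ ≤ ε ∧ ‖p.1 (p.2.1 + p.2.2) - φ p.1‖ < ε)
    (fun p q => q.1 (p.2.1 + p.2.2) = 0 ∧ ‖p.1 (q.2.1 + q.2.2) - φ p.1‖ < ε)
    (fun s _ => by
      obtain ⟨y, hy1, hy0, hyφ⟩ := exists_dual_eq_zero_on_finset φ hd hdist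
        (s.image fun p => p.2.1 + p.2.2)
      obtain ⟨u, hu, e, he, hue⟩ := exists_convexHull_approx φ hε.le hφB
        (insert y (s.image fun p => p.1)) hε
      refine ⟨(y, u, e), ⟨hy1, hyφ, hu, he, hue y (Finset.mem_insert_self _ _)⟩, fun p hp =>
        ⟨hy0 _ (Finset.mem_image_of_mem _ hp), hue _ (Finset.mem_insert_of_mem
          (Finset.mem_image_of_mem _ hp))⟩⟩)
  have hhull : ∀ n, ∃ t : Finset X, (t : Set X) ⊆ B ∧ (f n).2.1 ∈ convexHull ℝ (t : Set X) :=
    fun n => by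
      have := (hfP n).2.2.1
      rw [convexHull_eq_union_convexHull_finite_subsets] at this
      simpa using this
  choose t htB ht using hhull
  have hw := fun n => (Finset.mem_convexHull' (R := ℝ)).1 (ht n)
  choose w hw0 hw1 hwu using hw
  let D : Set X := ⋃ n, (t n : Set X)
  have hDc : D.Countable := Set.countable_iUnion fun n => (t n).countable_toSet
  have hDB : D ⊆ B := Set.iUnion_subset htB
  let S : Set (WeakSpace 𝕜 X) := closure (toWeakSpace 𝕜 X '' D)
  have hSB : S ⊆ toWeakSpace 𝕜 X '' B :=
    closure_minimal (Set.image_mono hDB) (IsCompact.isClosed hB)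
  have hS : IsCompact S := IsCompact.of_isClosed_subset hB isClosed_closure hSB
  have htD : ∀ n, ∀ x ∈ t n, toWeakSpace 𝕜 X x ∈ S := fun n x hx =>
    subset_closure ⟨x, Set.mem_iUnion.2 ⟨n, hx⟩, rfl⟩
  obtain ⟨k, hk, l, hl1, hl⟩ := exists_subseq_tendsto_on_closure (fun n => (f n).1)
    (fun n => (hfP n).1) hDc
  obtain ⟨R, hR0, hR⟩ := hB.exists_norm_le
  have hsum : ∀ (y : StrongDual 𝕜 X) n, y (f n).2.1 = ∑ x ∈ t n, (w n x : 𝕜) * y x := by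
    intro y n
    rw [← hwu n, map_sum]
    refine Finset.sum_congr rfl fun x _ => ?_
    rw [← algebraMap_smul 𝕜 (w n x) x, map_smul, smul_eq_mul]
  obtain ⟨i, hi⟩ := (eventually_frequently_sum_lt_of_pointwise_tendsto hS t w
    (toWeakSpace 𝕜 X) hw0 hw1 htD
    (fun i z => ‖((f (k i)).1 - l) ((toWeakSpace 𝕜 X).symm z)‖)
    (fun i => (weakSpace_apply_continuous _).norm) (B := 2 * R) (by
      intro i z hz
      obtain ⟨x, hx, rfl⟩ := hSB hz
      rw [abs_norm, LinearEquiv.symm_apply_apply]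
      refine ContinuousLinearMap.le_of_opNorm_le_of_le _ ?_ (hR x hx)
      refine (norm_sub_le _ _).trans ?_
      linarith [(hfP (k i)).1])
    (by
      intro z hz
      have := ((hl z hz).sub_const (l ((toWeakSpace 𝕜 X).symm z))).norm
      simpa using this) hε).exists
  obtain ⟨n, hn, hni⟩ := (hi.and_eventually (eventually_gt_atTop (k i))).exists
  have h1 : ‖((f (k i)).1 - l) (f n).2.1‖ < ε := by
    rw [hsum]
    refine (norm_sum_le _ _).trans_lt (lt_of_eq_of_lt (Finset.sum_congr rfl fun x hx => ?_) hn)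
    rw [norm_mul, RCLike.norm_ofReal, abs_of_nonneg (hw0 n x hx), LinearEquiv.symm_apply_apply]
  have h2 : ‖(f (k i)).1 ((f n).2.1 + (f n).2.2) - φ (f (k i)).1‖ < ε := (hfr _ _ hni).2
  have h3 : ‖(f (k i)).1 (f n).2.2‖ ≤ ε := by
    simpa using ContinuousLinearMap.le_of_opNorm_le_of_le _ (hfP (k i)).1 (hfP n).2.2.2.1
  have h4 : ‖l (f n).2.1‖ ≤ ε := by
    have hlim : Tendsto (fun j => (f (k j)).1 (f n).2.1) atTop (𝓝 (l (f n).2.1)) := by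
      simp only [hsum]
      exact tendsto_finsetSum _ fun x hx => (hl _ (htD n x hx)).const_mul _
    refine le_of_tendsto hlim.norm ?_
    filter_upwards [hk.tendsto_atTop.eventually_gt_atTop n] with j hj
    have h0 := (hfr _ _ hj).1
    rw [map_add, add_eq_zero_iff_eq_neg] at h0
    rw [h0, norm_neg]
    simpa using ContinuousLinearMap.le_of_opNorm_le_of_le _ (hfP (k j)).1 (hfP n).2.2.2.1
  have h5 : φ (f (k i)).1 = ((f (k i)).1 - l) (f n).2.1 + l (f n).2.1 + (f (k i)).1 (f n).2.2
      - ((f (k i)).1 ((f n).2.1 + (f n).2.2) - φ (f (k i)).1) := by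
    simp only [sub_apply, map_add]
    ring
  have h6 : ‖φ (f (k i)).1‖ ≤ 4 * ε := by
    rw [h5]
    refine (norm_sub_le _ _).trans ?_
    have := norm_add₃_le (a := ((f (k i)).1 - l) (f n).2.1) (b := l (f n).2.1)
      (c := (f (k i)).1 (f n).2.2)
    linarith
  linarith [(hfP (k i)).2.1]

end Representation

/-! ### The dual Mackey topology and its sequentially continuous seminorms -/

theorem RCLike.norm_add_norm_eq_one_of_nonneg {𝕜 : Type*} [RCLike 𝕜] {a b : 𝕜} (ha : 0 ≤ a)
    (hb : 0 ≤ b) (hab : a + b = 1) : ‖a‖ + ‖b‖ = 1 := by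
  have h : ((‖a‖ + ‖b‖ : ℝ) : 𝕜) = ((1 : ℝ) : 𝕜) := by
    rw [RCLike.ofReal_add, RCLike.norm_of_nonneg' ha, RCLike.norm_of_nonneg' hb, hab,
      RCLike.ofReal_one]
  exact RCLike.ofReal_injective h

theorem SeminormFamily.tendsto_moduleFilterBasis_iff {𝕜 E ι κ : Type*} [RCLike 𝕜]
    [AddCommGroup E] [Module 𝕜 E] [Nonempty ι] (p : SeminormFamily 𝕜 E ι) (u : κ → E)
    (l : Filter κ) (y : E) :
    Tendsto u l (@nhds E p.moduleFilterBasis.topology y) ↔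
      ∀ i, Tendsto (fun n => p i (u n - y)) l (𝓝 0) := by
  let _ := p.moduleFilterBasis.topology
  have hp : WithSeminorms p := ⟨rfl⟩
  rw [hp.tendsto_nhds]
  refine forall_congr' fun i => ?_
  rw [Metric.tendsto_nhds]
  simp [abs_of_nonneg]

theorem SeminormFamily.mem_nhds_moduleFilterBasis_iff {𝕜 E ι : Type*} [RCLike 𝕜]
    [AddCommGroup E] [Module 𝕜 E] [Nonempty ι] (p : SeminormFamily 𝕜 E ι) (y : E) (U : Set E) :
    U ∈ @nhds E p.moduleFilterBasis.topology y ↔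
      ∃ s : Finset ι, ∃ r : ℝ, 0 < r ∧ ∀ z, (∀ i ∈ s, p i (z - y) < r) → z ∈ U := by
  let _ := p.moduleFilterBasis.topology
  have hp : WithSeminorms p := ⟨rfl⟩
  rw [hp.mem_nhds_iff]
  refine exists_congr fun s => exists_congr fun r => and_congr_right fun hr => ?_
  rw [Seminorm.ball_finset_sup_eq_iInter _ _ _ hr]
  refine forall_congr' fun z => ?_
  simp only [Set.mem_iInter, Seminorm.mem_ball]

theorem Seminorm.exists_dual_apply_eq {𝕜 E : Type*} [RCLike 𝕜] [AddCommGroup E] [Module 𝕜 E]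
    (p : Seminorm 𝕜 E) (x : E) :
    ∃ g : Module.Dual 𝕜 E, (∀ z, ‖g z‖ ≤ p z) ∧ g x = (p x : 𝕜) := by
  let _ : SeminormedAddCommGroup E := p.toSeminormedAddCommGroup
  let _ : NormedSpace 𝕜 E := { norm_smul_le := fun a y => (map_smul_eq_mul p a y).le }
  obtain ⟨g, hg1, hgx⟩ := exists_dual_vector'' 𝕜 x
  refine ⟨g.toLinearMap, fun z => ?_, hgx⟩
  exact (g.le_of_opNorm_le hg1 z).trans_eq (one_mul _)

section Mackey

variable {𝕜 X : Type*} [RCLike 𝕜] [NormedAddCommGroup X] [NormedSpace 𝕜 X]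

theorem IsCompact.isWeaklyCompact {K : Set X} (hK : IsCompact K) : IsWeaklyCompact 𝕜 K :=
  hK.image (toWeakSpaceCLM 𝕜 X).continuous

theorem le_dualMackeySeminorm (K : WeaklyCompactAbsConvex 𝕜 X) (y : StrongDual 𝕜 X) {x : X}
    (hx : x ∈ K.1) : ‖y x‖ ≤ dualMackeySeminorm 𝕜 X K y :=
  le_ciSup (K.2.1.bddAbove_norm_apply y) (⟨x, hx⟩ : K.1)

theorem dualMackeySeminorm_le (K : WeaklyCompactAbsConvex 𝕜 X) (y : StrongDual 𝕜 X) {c : ℝ}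
    (hc : 0 ≤ c) (h : ∀ x ∈ K.1, ‖y x‖ ≤ c) : dualMackeySeminorm 𝕜 X K y ≤ c :=
  Real.iSup_le (fun x : K.1 => h x x.2) hc

theorem exists_dualMackeySeminorm_le_norm (K : WeaklyCompactAbsConvex 𝕜 X) :
    ∃ R : ℝ, 0 ≤ R ∧ ∀ y, dualMackeySeminorm 𝕜 X K y ≤ R * ‖y‖ := by
  obtain ⟨R, hR0, hR⟩ := K.2.1.exists_norm_le
  refine ⟨R, hR0, fun y => dualMackeySeminorm_le K y (by positivity) fun x hx => ?_⟩
  rw [mul_comm]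
  exact y.le_of_opNorm_le_of_le le_rfl (hR x hx)

variable (𝕜) in
theorem exists_weaklyCompactAbsConvex_mem (x : X) : ∃ K : WeaklyCompactAbsConvex 𝕜 X, x ∈ K.1 := by
  refine ⟨⟨(fun a : 𝕜 => a • x) '' Metric.closedBall 0 1, ?_, ?_, ?_⟩, 1, by simp, by simp⟩
  · exact ((isCompact_closedBall _ _).image (by fun_prop)).isWeaklyCompact
  · rw [balanced_iff_smul_mem]
    rintro a ha _ ⟨b, hb, rfl⟩
    refine ⟨a * b, ?_, by simp [mul_smul]⟩
    rw [mem_closedBall_zero_iff] at hb ⊢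
    rw [norm_mul]
    exact mul_le_one₀ ha (norm_nonneg _) hb
  · rintro _ ⟨b, hb, rfl⟩ _ ⟨c, hc, rfl⟩ r t hr ht hrt
    refine ⟨r * b + t * c, ?_, by simp [mul_smul, add_smul]⟩
    rw [mem_closedBall_zero_iff] at hb hc ⊢
    calc ‖r * b + t * c‖ ≤ ‖r‖ * ‖b‖ + ‖t‖ * ‖c‖ :=
          (norm_add_le _ _).trans_eq (by rw [norm_mul, norm_mul])
      _ ≤ ‖r‖ * 1 + ‖t‖ * 1 := by gcongr
      _ = 1 := by
        rw [mul_one, mul_one, RCLike.norm_add_norm_eq_one_of_nonneg hr ht hrt]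

theorem exists_norm_le_of_dualMackeySeminorm_tendsto [CompleteSpace X] (y : ℕ → StrongDual 𝕜 X)
    (hy : ∀ K, Tendsto (fun n => dualMackeySeminorm 𝕜 X K (y n)) atTop (𝓝 0)) :
    ∃ C : ℝ, ∀ n, ‖y n‖ ≤ C := by
  refine banach_steinhaus fun x => ?_
  obtain ⟨K, hK⟩ := exists_weaklyCompactAbsConvex_mem 𝕜 x
  obtain ⟨C, hC⟩ := (hy K).bddAbove_range
  exact ⟨C, fun n => (le_dualMackeySeminorm K (y n) hK).trans (hC ⟨n, rfl⟩)⟩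

variable (𝕜 X) in
/-- Every norm bounded functional on `X'` that is sequentially continuous for `μ(X', X)` is the
evaluation at a point of `X`. -/
def SeqMackeyDualIsEvaluation : Prop :=
  ∀ φ : StrongDual 𝕜 (StrongDual 𝕜 X),
    (∀ y : ℕ → StrongDual 𝕜 X,
      (∀ K, Tendsto (fun n => dualMackeySeminorm 𝕜 X K (y n)) atTop (𝓝 0)) →
        Tendsto (fun n => φ (y n)) atTop (𝓝 0)) →
    ∃ x : X, ∀ y, φ y = y x

/-- If every sequentially `μ(X', X)`-continuous functional is an evaluation, then every
sequentially `μ(X', X)`-continuous seminorm is dominated by some `p_K`. -/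
theorem exists_le_dualMackeySeminorm_of_seqContinuous (hX : SeqMackeyDualIsEvaluation 𝕜 X)
    (p : Seminorm 𝕜 (StrongDual 𝕜 X)) {C : ℝ} (hpC : ∀ y, p y ≤ C * ‖y‖)
    (hp : ∀ y : ℕ → StrongDual 𝕜 X,
      (∀ K, Tendsto (fun n => dualMackeySeminorm 𝕜 X K (y n)) atTop (𝓝 0)) →
        Tendsto (fun n => p (y n)) atTop (𝓝 0)) :
    ∃ K, ∀ y, p y ≤ dualMackeySeminorm 𝕜 X K y := by
  have hrep : ∀ g : Module.Dual 𝕜 (StrongDual 𝕜 X), (∀ y, ‖g y‖ ≤ p y) → ∃ x : X, ∀ y, g y = y x := by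
    intro g hg
    obtain ⟨x, hx⟩ := hX (g.mkContinuous C fun y => (hg y).trans (hpC y)) fun y hy =>
      squeeze_zero_norm (fun n => hg (y n)) (hp y hy)
    exact ⟨x, fun y => hx y⟩
  let K : Set X := {x | ∀ y : StrongDual 𝕜 X, ‖y x‖ ≤ p y}
  have hKc : IsWeaklyCompact 𝕜 K := by
    let Φ : WeakSpace 𝕜 X → StrongDual 𝕜 X → 𝕜 := fun z y => y ((toWeakSpace 𝕜 X).symm z)
    have hΦ : IsInducing Φ := ⟨rfl⟩
    have himg : Φ '' (toWeakSpace 𝕜 X '' K) =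
        (Set.univ.pi fun y => Metric.closedBall (0 : 𝕜) (p y)) ∩
          Set.range ((↑) : (StrongDual 𝕜 X →ₗ[𝕜] 𝕜) → StrongDual 𝕜 X → 𝕜) := by
      ext h
      constructor
      · rintro ⟨_, ⟨x, hx, rfl⟩, rfl⟩
        refine ⟨fun y _ => by simpa [Φ] using hx y, ?_⟩
        exact ⟨(NormedSpace.inclusionInDoubleDual 𝕜 X x).toLinearMap, by ext y; simp [Φ]⟩
      · rintro ⟨hh, g, rfl⟩
        have hg : ∀ y, ‖g y‖ ≤ p y := fun y => by simpa using hh y trivial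
        obtain ⟨x, hx⟩ := hrep g hg
        refine ⟨_, ⟨x, fun y => ?_, rfl⟩, ?_⟩
        · rw [← hx]; exact hg y
        · ext y; simp [Φ, hx]
    rw [IsWeaklyCompact, hΦ.isCompact_iff, himg]
    exact (isCompact_univ_pi fun y => isCompact_closedBall _ _).inter_right
      (LinearMap.isClosed_range_coe _ _ _)
  have hKa : AbsConvex 𝕜 K := by
    constructor
    · rw [balanced_iff_smul_mem]
      intro a ha x hx y
      rw [map_smul, norm_smul]
      exact (mul_le_of_le_one_left (norm_nonneg _) ha).trans (hx y)
    · intro x hx z hz r t hr ht hrt y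
      calc ‖y (r • x + t • z)‖ ≤ ‖r‖ * ‖y x‖ + ‖t‖ * ‖y z‖ := by
            rw [map_add, map_smul, map_smul, ← norm_smul, ← norm_smul]
            exact norm_add_le _ _
        _ ≤ ‖r‖ * p y + ‖t‖ * p y := by
          gcongr
          exacts [hx y, hz y]
        _ = p y := by
          rw [← add_mul, RCLike.norm_add_norm_eq_one_of_nonneg hr ht hrt, one_mul]
  refine ⟨⟨K, hKc, hKa⟩, fun y => ?_⟩
  obtain ⟨g, hgp, hgy⟩ := p.exists_dual_apply_eq y
  obtain ⟨x, hx⟩ := hrep g hgp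
  have hxK : x ∈ K := fun z => by rw [← hx]; exact hgp z
  refine le_trans ?_ (le_dualMackeySeminorm ⟨K, hKc, hKa⟩ y hxK)
  rw [← hx, hgy, RCLike.norm_ofReal]
  exact le_abs_self _

end Mackey

section Classes

variable {𝕜 X : Type*} [RCLike 𝕜] [NormedAddCommGroup X] [NormedSpace 𝕜 X]

theorem tendsto_dualMackeyTopology_iff {κ : Type*} (u : κ → StrongDual 𝕜 X) (l : Filter κ)
    (y : StrongDual 𝕜 X) :
    Tendsto u l (@nhds _ (dualMackeyTopology 𝕜 X) y) ↔
      ∀ K, Tendsto (fun n => dualMackeySeminorm 𝕜 X K (u n - y)) l (𝓝 0) :=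
  SeminormFamily.tendsto_moduleFilterBasis_iff (dualMackeySeminorm 𝕜 X) u l y

theorem mem_nhds_dualMackeyTopology_iff (y : StrongDual 𝕜 X) (U : Set (StrongDual 𝕜 X)) :
    U ∈ @nhds _ (dualMackeyTopology 𝕜 X) y ↔
      ∃ s : Finset (WeaklyCompactAbsConvex 𝕜 X), ∃ r : ℝ, 0 < r ∧
        ∀ z, (∀ K ∈ s, dualMackeySeminorm 𝕜 X K (z - y) < r) → z ∈ U :=
  SeminormFamily.mem_nhds_moduleFilterBasis_iff (dualMackeySeminorm 𝕜 X) y U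

theorem tendsto_apply_of_tendsto_dualMackey {κ : Type*} {u : κ → StrongDual 𝕜 X} {l : Filter κ}
    {y : StrongDual 𝕜 X}
    (h : ∀ K, Tendsto (fun n => dualMackeySeminorm 𝕜 X K (u n - y)) l (𝓝 0)) (x : X) :
    Tendsto (fun n => u n x) l (𝓝 (y x)) := by
  obtain ⟨K, hK⟩ := exists_weaklyCompactAbsConvex_mem 𝕜 x
  rw [tendsto_iff_norm_sub_tendsto_zero]
  exact squeeze_zero (fun _ => norm_nonneg _) (fun n => le_dualMackeySeminorm K (u n - y) hK) (h K)

/-- On a weakly sequentially complete space with an almost shrinking basis, sequentially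
`μ(X', X)`-continuous functionals are evaluations. -/
theorem seqMackeyDualIsEvaluation_of_almostShrinking (hX : IsWeaklySeqComplete 𝕜 X)
    (hb : HasAlmostShrinkingBasis 𝕜 X) : SeqMackeyDualIsEvaluation 𝕜 X := by
  intro φ hφ
  obtain ⟨b, c, -, hc⟩ := hb
  have hexp : ∀ y K, Tendsto (fun N => dualMackeySeminorm 𝕜 X K
      (∑ n ∈ Finset.range N, c n y • b.coord n - y)) atTop (𝓝 0) := fun y =>
    (tendsto_dualMackeyTopology_iff _ _ _).1 ((hc y fun n => c n y).2 fun _ => rfl)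
  have hcoord : ∀ y m, y (b m) = c m y := fun y m => by
    refine tendsto_nhds_unique (tendsto_apply_of_tendsto_dualMackey (hexp y) (b m))
      (tendsto_const_nhds.congr' ?_)
    filter_upwards [eventually_gt_atTop m] with N hN
    simp [b.ortho, Pi.single_apply, hN]
  have hlim : ∀ y, Tendsto (fun N => y (∑ n ∈ Finset.range N, φ (b.coord n) • b n)) atTop
      (𝓝 (φ y)) := fun y => by
    have h := (hφ _ (hexp y)).add_const (φ y)
    rw [zero_add] at h
    refine h.congr fun N => ?_
    simp [hcoord, mul_comm]
  obtain ⟨l, hl⟩ := hX (fun N => ∑ n ∈ Finset.range N, φ (b.coord n) • b n)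
    fun y => (hlim y).cauchySeq
  refine ⟨l, fun y => tendsto_nhds_unique (hlim y) ?_⟩
  exact ((weakSpace_apply_continuous y).tendsto _).comp hl

/-- On a strongly weakly compactly generated space, sequentially `μ(X', X)`-continuous functionals
are evaluations. -/
theorem IsSWCG.seqMackeyDualIsEvaluation [CompleteSpace X] (hX : IsSWCG 𝕜 X) :
    SeqMackeyDualIsEvaluation 𝕜 X := by
  intro φ hφ
  obtain ⟨K, hK, hKL⟩ := hX
  refine exists_eq_apply_of_dominated_by_isWeaklyCompact φ fun ε hε => ?_
  obtain ⟨δ, hδ, hδφ⟩ : ∃ δ : ℝ, 0 < δ ∧ ∀ y : StrongDual 𝕜 X, ‖y‖ ≤ 1 →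
      (∀ k ∈ K, ‖y k‖ ≤ δ) → ‖φ y‖ ≤ ε := by
    by_contra! hcon
    choose y hy1 hyK hyφ using fun n : ℕ => hcon (1 / ((n : ℝ) + 1)) (by positivity)
    have hy0 : ∀ L, Tendsto (fun n => dualMackeySeminorm 𝕜 X L (y n)) atTop (𝓝 0) := by
      intro L
      rw [Metric.tendsto_atTop']
      intro η hη
      obtain ⟨m, hm⟩ := hKL L.1 L.2.1 (η / 2) (by positivity)
      obtain ⟨N, hN⟩ := exists_nat_gt (2 * m / η)
      refine ⟨N, fun n hn => ?_⟩
      rw [Real.dist_eq, sub_zero, abs_of_nonneg (apply_nonneg _ _)]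
      have hle : dualMackeySeminorm 𝕜 X L (y n) ≤ m * (1 / ((n : ℝ) + 1)) + η / 2 := by
        refine dualMackeySeminorm_le _ _ (by positivity) fun x hx => ?_
        obtain ⟨_, ⟨k, hk, rfl⟩, e, he, rfl⟩ := hm hx
        rw [mem_closedBall_zero_iff] at he
        have h1 : ‖y n ((m : 𝕜) • k)‖ ≤ m * (1 / ((n : ℝ) + 1)) := by
          rw [map_smul, norm_smul, RCLike.norm_natCast]
          gcongr
          exact hyK n k hk
        have h2 : ‖y n e‖ ≤ η / 2 := by
          simpa using (y n).le_of_opNorm_le_of_le (hy1 n) he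
        calc ‖y n ((fun x => (m : 𝕜) • x) k + e)‖ ≤ ‖y n ((m : 𝕜) • k)‖ + ‖y n e‖ := by
              rw [map_add]; exact norm_add_le _ _
          _ ≤ _ := add_le_add h1 h2
      have hlt : m * (1 / ((n : ℝ) + 1)) < η / 2 := by
        have hnN : (N : ℝ) < n := by exact_mod_cast hn
        have h3 : 2 * m / η < (n : ℝ) + 1 := by linarith
        rw [div_lt_iff₀ hη] at h3
        rw [mul_one_div, div_lt_iff₀ (by positivity)]
        linarith
      linarith
    have := ((hφ y hy0).norm.eventually_lt_const (by simpa using hε)).exists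
    obtain ⟨n, hn⟩ := this
    exact (hyφ n).not_gt hn
  set c := ‖φ‖ / δ with hc
  have hc0 : 0 ≤ c := by positivity
  refine ⟨(fun q : 𝕜 × X => q.1 • q.2) '' (Metric.closedBall 0 c ×ˢ insert 0 K), ?_, ?_⟩
  · have hK0 : IsCompact (toWeakSpace 𝕜 X '' insert 0 K) := by
      rw [Set.image_insert_eq]
      exact hK.insert _
    have := ((isCompact_closedBall (0 : 𝕜) c).prod hK0).image
      (f := fun q : 𝕜 × WeakSpace 𝕜 X => q.1 • q.2) (by fun_prop)
    rw [IsWeaklyCompact]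
    convert this using 1
    ext z
    simp only [Set.mem_image, Prod.exists, Set.mem_prod]
    constructor
    · rintro ⟨_, ⟨a, x, ⟨ha, hx⟩, rfl⟩, rfl⟩
      exact ⟨a, toWeakSpace 𝕜 X x, ⟨ha, x, hx, rfl⟩, by simp⟩
    · rintro ⟨a, _, ⟨ha, x, hx, rfl⟩, rfl⟩
      exact ⟨_, ⟨a, x, ⟨ha, hx⟩, rfl⟩, by simp⟩
  · intro y u hu
    have hu0 : 0 ≤ u := by
      simpa using hu _ ⟨((0 : 𝕜), (0 : X)), ⟨by simpa using hc0, Set.mem_insert _ _⟩, rfl⟩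
    have huK : ∀ k ∈ K, c * ‖y k‖ ≤ u := by
      intro k hk
      rcases eq_or_ne (y k) 0 with h0 | h0
      · simpa [h0] using hu0
      have h0' : ‖y k‖ ≠ 0 := norm_ne_zero_iff.mpr h0
      have h := hu _ ⟨(((c / ‖y k‖ : ℝ) : 𝕜) * starRingEnd 𝕜 (y k), k), ⟨by
        rw [mem_closedBall_zero_iff, norm_mul, RCLike.norm_conj, RCLike.norm_ofReal,
          abs_of_nonneg (by positivity), div_mul_cancel₀ _ h0'], Set.mem_insert_of_mem _ hk⟩, rfl⟩
      simp only [map_smul y, smul_eq_mul] at h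
      rw [mul_assoc, RCLike.conj_mul, RCLike.re_ofReal_mul, ← RCLike.ofReal_pow,
        RCLike.ofReal_re] at h
      calc c * ‖y k‖ = c / ‖y k‖ * ‖y k‖ ^ 2 := by field_simp
        _ ≤ u := h
    refine (RCLike.re_le_norm _).trans ?_
    rcases eq_or_ne y 0 with rfl | hy
    · simpa using hu0
    have hypos : 0 < ‖y‖ := norm_pos_iff.mpr hy
    by_cases hsmall : ∀ k ∈ K, ‖y k‖ ≤ δ * ‖y‖
    · have h := hδφ (((‖y‖⁻¹ : ℝ) : 𝕜) • y) (by
        rw [norm_smul, RCLike.norm_ofReal, abs_inv, abs_norm, inv_mul_cancel₀ hypos.ne'])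
        (fun k hk => by
          rw [smul_apply, norm_smul, RCLike.norm_ofReal, abs_inv, abs_norm,
            inv_mul_le_iff₀ hypos]
          linarith [hsmall k hk])
      rw [map_smul, norm_smul, RCLike.norm_ofReal, abs_inv, abs_norm,
        inv_mul_le_iff₀ hypos] at h
      linarith
    · push Not at hsmall
      obtain ⟨k, hk, hky⟩ := hsmall
      have h1 : ‖φ y‖ ≤ c * ‖y k‖ := calc
        ‖φ y‖ ≤ ‖φ‖ * ‖y‖ := φ.le_opNorm y
        _ = c * (δ * ‖y‖) := by rw [hc]; field_simp
        _ ≤ c * ‖y k‖ := by gcongr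
      have := huK k hk
      have : 0 ≤ ε * ‖y‖ := by positivity
      linarith

/-- In a separable Schur space, weakly compact sets are norm compact. -/
theorem IsSchurSpace.isCompact_of_isWeaklyCompact [TopologicalSpace.SeparableSpace X]
    (hX : IsSchurSpace 𝕜 X) {L : Set X} (hL : IsWeaklyCompact 𝕜 L) : IsCompact L := by
  choose g hg1 hgx using fun n => exists_dual_vector'' 𝕜 (TopologicalSpace.denseSeq X n)
  have hsep : ∀ x, (∀ n, g n x = 0) → x = 0 := by
    intro x hx
    rw [← norm_le_zero_iff]
    refine le_of_forall_pos_le_add fun ε hε => ?_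
    obtain ⟨n, hn⟩ := Metric.denseRange_iff.1 (TopologicalSpace.denseRange_denseSeq X) x (ε / 2)
      (by positivity)
    set d := TopologicalSpace.denseSeq X n
    have h1 : ‖d‖ ≤ ‖d - x‖ := by
      have h2 : g n (d - x) = (‖d‖ : 𝕜) := by rw [map_sub, hx, sub_zero, hgx]
      have h3 := (g n).le_of_opNorm_le (hg1 n) (d - x)
      rw [h2, one_mul, RCLike.norm_ofReal, abs_norm] at h3
      exact h3
    rw [dist_eq_norm] at hn
    rw [norm_sub_rev] at h1
    have h4 : ‖x‖ ≤ ‖x - d‖ + ‖d‖ := by simpa using norm_add_le (x - d) d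
    linarith
  let S := toWeakSpace 𝕜 X '' L
  have : CompactSpace S := isCompact_iff_compactSpace.mp hL
  have : TopologicalSpace.MetrizableSpace S :=
    Metric.PiNatEmbed.TopologicalSpace.MetrizableSpace.of_countable_separating
      (fun n (z : S) => g n ((toWeakSpace 𝕜 X).symm z))
      (fun n => (weakSpace_apply_continuous (g n)).comp continuous_subtype_val) (by
        intro z w hzw
        by_contra! h
        refine hzw (Subtype.ext ((toWeakSpace 𝕜 X).symm.injective ?_))
        rw [← sub_eq_zero]
        exact hsep _ fun n => by rw [map_sub, h n, sub_self])
  refine IsSeqCompact.isCompact fun x hx => ?_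
  let z : ℕ → S := fun n => ⟨toWeakSpace 𝕜 X (x n), x n, hx n, rfl⟩
  obtain ⟨⟨_, l, hl, rfl⟩, k, hk, hlim⟩ := CompactSpace.tendsto_subseq z
  refine ⟨l, hl, k, hk, hX _ _ ?_⟩
  exact (continuous_subtype_val.tendsto _).comp hlim

/-- Every separable Schur space is strongly weakly compactly generated. -/
theorem IsSchurSpace.isSWCG [TopologicalSpace.SeparableSpace X] (hX : IsSchurSpace 𝕜 X) :
    IsSWCG 𝕜 X := by
  let d := TopologicalSpace.denseSeq X
  let r : ℕ → ℝ := fun n => ((n : ℝ) + 1) * (1 + ‖d n‖)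
  have hr : ∀ n, 0 < r n := fun n => by positivity
  let z : ℕ → X := fun n => (((r n)⁻¹ : ℝ) : 𝕜) • d n
  have hz : Tendsto z atTop (𝓝 0) := by
    refine squeeze_zero_norm (fun n => ?_) tendsto_one_div_add_atTop_nhds_zero_nat
    rw [norm_smul, RCLike.norm_ofReal, abs_of_pos (inv_pos.2 (hr n)), inv_mul_le_iff₀ (hr n)]
    simp only [r]
    have : ((n : ℝ) + 1) * (1 + ‖d n‖) * (1 / ((n : ℝ) + 1)) = 1 + ‖d n‖ := by field_simp
    linarith
  refine ⟨(fun q : 𝕜 × X => q.1 • q.2) '' (Metric.closedBall 0 1 ×ˢ insert 0 (Set.range z)),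
    (((isCompact_closedBall (0 : 𝕜) 1).prod hz.isCompact_insert_range).image
      (by fun_prop)).isWeaklyCompact, fun L hL ε hε => ?_⟩
  obtain ⟨t, ht⟩ := (hX.isCompact_of_isWeaklyCompact hL).elim_finite_subcover
    (fun n => Metric.ball (d n) ε) (fun n => Metric.isOpen_ball) (fun x _ => by
      obtain ⟨n, hn⟩ := Metric.denseRange_iff.1 (TopologicalSpace.denseRange_denseSeq X) x ε hε
      exact Set.mem_iUnion.2 ⟨n, hn⟩)
  obtain ⟨N, hN⟩ := exists_nat_ge (∑ n ∈ t, r n)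
  refine ⟨N, fun x hx => ?_⟩
  obtain ⟨n, hn, hxn⟩ := Set.mem_iUnion₂.1 (ht hx)
  have hrN : r n ≤ N := (Finset.single_le_sum (fun m _ => (hr m).le) hn).trans hN
  have hNpos : (0 : ℝ) < N := (hr n).trans_le hrN
  have hN0 : (N : 𝕜) ≠ 0 := by
    intro h
    have h' : ((N : ℝ) : 𝕜) = ((0 : ℝ) : 𝕜) := by simpa using h
    exact hNpos.ne' (RCLike.ofReal_injective h')
  refine ⟨d n, ⟨((r n / N : ℝ) : 𝕜) • z n, ⟨(((r n / N : ℝ) : 𝕜), z n), ⟨?_,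
    Set.mem_insert_of_mem _ ⟨n, rfl⟩⟩, rfl⟩, ?_⟩, x - d n, ?_, by simp⟩
  · rw [mem_closedBall_zero_iff, RCLike.norm_ofReal, abs_of_nonneg (by positivity)]
    exact (div_le_one hNpos).2 hrN
  · have hr0 : ((r n : ℝ) : 𝕜) ≠ 0 := fun h =>
      (hr n).ne' (RCLike.ofReal_injective (by rw [h, RCLike.ofReal_zero]))
    simp only [z, smul_smul]
    convert one_smul 𝕜 (d n) using 2
    push_cast
    field_simp
  · rw [mem_closedBall_zero_iff, ← dist_eq_norm]
    exact (Metric.mem_ball.1 hxn).le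

end Classes

section Semigroup

variable {𝕜 X : Type*} [RCLike 𝕜] [NormedAddCommGroup X] [NormedSpace 𝕜 X]

theorem dualMackeySeminorm_rescale (K : WeaklyCompactAbsConvex 𝕜 X) (α : ℝ)
    (T : ℝ≥0 → StrongDual 𝕜 X →L[𝕜] StrongDual 𝕜 X) (t : ℝ≥0) (y : StrongDual 𝕜 X) :
    dualMackeySeminorm 𝕜 X K (rescale α T t y) =
      Real.exp (-α * t) * dualMackeySeminorm 𝕜 X K (T t y) := by
  rw [rescale, smul_apply, map_smul_eq_mul, RCLike.norm_ofReal, Real.abs_exp]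

/-- If sequentially `μ(X', X)`-continuous functionals are evaluations, then a suitable rescaling
of a `μ(X', X)`-bi-continuous semigroup is dominated by Mackey seminorms. -/
theorem IsBiContinuousSemigroup.exists_dualMackeySeminorm_rescale_le [CompleteSpace X]
    (hX : SeqMackeyDualIsEvaluation 𝕜 X) {T : ℝ≥0 → StrongDual 𝕜 X →L[𝕜] StrongDual 𝕜 X}
    (hT : IsBiContinuousSemigroup T (dualMackeyTopology 𝕜 X)) :
    ∃ α : ℝ, ∀ K, ∃ K', ∀ t y,
      dualMackeySeminorm 𝕜 X K (rescale α T t y) ≤ dualMackeySeminorm 𝕜 X K' y := by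
  obtain ⟨M, hM, ω, hω⟩ := hT.exp_bounded
  refine ⟨ω + 1, fun K => ?_⟩
  obtain ⟨R, hR0, hR⟩ := exists_dualMackeySeminorm_le_norm K
  have hdecay : ∀ (t : ℝ≥0) y, dualMackeySeminorm 𝕜 X K (rescale (ω + 1) T t y) ≤
      Real.exp (-t) * (R * M * ‖y‖) := by
    intro t y
    rw [dualMackeySeminorm_rescale]
    calc Real.exp (-(ω + 1) * t) * dualMackeySeminorm 𝕜 X K (T t y)
        ≤ Real.exp (-(ω + 1) * t) * (R * (M * Real.exp (ω * t) * ‖y‖)) := by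
          gcongr
          refine (hR _).trans ?_
          gcongr
          exact (T t).le_of_opNorm_le (hω t) y
      _ = (Real.exp (-(ω + 1) * t) * Real.exp (ω * t)) * (R * M * ‖y‖) := by ring
      _ = Real.exp (-t) * (R * M * ‖y‖) := by
        rw [← Real.exp_add]
        ring_nf
  have hbound : ∀ (t : ℝ≥0) y, dualMackeySeminorm 𝕜 X K (rescale (ω + 1) T t y) ≤
      R * M * ‖y‖ := fun t y =>
    (hdecay t y).trans (mul_le_of_le_one_left (by positivity) (Real.exp_le_one_iff.2 (by simp)))
  have hbdd : ∀ y, BddAbove (Set.range fun t : ℝ≥0 =>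
      dualMackeySeminorm 𝕜 X K (rescale (ω + 1) T t y)) := fun y =>
    ⟨R * M * ‖y‖, by rintro _ ⟨t, rfl⟩; exact hbound t y⟩
  let p : Seminorm 𝕜 (StrongDual 𝕜 X) := Seminorm.of
    (fun y => ⨆ t : ℝ≥0, dualMackeySeminorm 𝕜 X K (rescale (ω + 1) T t y))
    (fun y z => ciSup_le fun t => by
      rw [_root_.map_add]
      exact (map_add_le_add _ _ _).trans (add_le_add (le_ciSup (hbdd y) t) (le_ciSup (hbdd z) t)))
    (fun a y => by
      simp only [map_smul, map_smul_eq_mul]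
      exact (Real.mul_iSup_of_nonneg (norm_nonneg a) _).symm)
  have hpt : ∀ t y, dualMackeySeminorm 𝕜 X K (rescale (ω + 1) T t y) ≤ p y := fun t y =>
    le_ciSup (hbdd y) t
  obtain ⟨K', hK'⟩ := exists_le_dualMackeySeminorm_of_seqContinuous hX p
    (fun y => ciSup_le fun t => hbound t y) (fun y hy => by
      obtain ⟨C, hC⟩ := exists_norm_le_of_dualMackeySeminorm_tendsto y hy
      have hy0 : Tendsto y atTop (@nhds _ (dualMackeyTopology 𝕜 X) 0) := by
        rw [tendsto_dualMackeyTopology_iff]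
        simpa using hy
      rw [Metric.tendsto_nhds]
      intro ε hε
      have hexp : Tendsto (fun t : ℝ≥0 => Real.exp (-t) * (R * M * C)) atTop (𝓝 0) := by
        have h := (Real.tendsto_exp_neg_atTop_nhds_zero.comp
          (NNReal.tendsto_coe_atTop.2 tendsto_id)).mul_const (R * M * C)
        simpa using h
      obtain ⟨t₀, ht₀⟩ := ((hexp.eventually_lt_const (half_pos hε))).exists_forall_of_atTop
      set A := Real.exp (|ω + 1| * t₀) with hA
      have hApos : 0 < A := Real.exp_pos _
      have hU : {z | dualMackeySeminorm 𝕜 X K z < ε / 2 / A} ∈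
          @nhds _ (dualMackeyTopology 𝕜 X) 0 := by
        rw [mem_nhds_dualMackeyTopology_iff]
        exact ⟨{K}, ε / 2 / A, by positivity, fun z hz => by simpa using hz⟩
      filter_upwards [hT.locally_biequicontinuous y 0 ⟨C, hC⟩ hy0 t₀ _ hU] with n hn
      rw [Real.dist_eq, sub_zero, abs_of_nonneg (apply_nonneg _ _)]
      refine lt_of_le_of_lt (b := ε / 2) (ciSup_le fun t => ?_) (by linarith)
      rcases le_total t t₀ with ht | ht
      · have h1 := hn t ht
        rw [sub_zero] at h1
        rw [dualMackeySeminorm_rescale]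
        calc Real.exp (-(ω + 1) * t) * dualMackeySeminorm 𝕜 X K (T t (y n))
            ≤ A * (ε / 2 / A) := by
              refine mul_le_mul ?_ h1.le (apply_nonneg _ _) hApos.le
              rw [hA, Real.exp_le_exp]
              have h2 : -(ω + 1) ≤ |ω + 1| := neg_le_abs _
              have h3 : (t : ℝ) ≤ t₀ := ht
              gcongr
          _ = ε / 2 := by field_simp
      · refine ((hdecay t (y n)).trans ?_).trans (ht₀ t ht).le
        gcongr
        exact hC n)
  exact ⟨K', fun t y => (hpt t y).trans (hK' y)⟩

theorem isTauEquicontinuous_of_dualMackeySeminorm_le {I : Type*}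
    {S : I → StrongDual 𝕜 X →L[𝕜] StrongDual 𝕜 X}
    (hS : ∀ K, ∃ K', ∀ t y, dualMackeySeminorm 𝕜 X K (S t y) ≤ dualMackeySeminorm 𝕜 X K' y) :
    IsTauEquicontinuous S (dualMackeyTopology 𝕜 X) := by
  classical
  choose K' hK' using hS
  intro x U hU
  obtain ⟨s, r, hr, hsU⟩ := (mem_nhds_dualMackeyTopology_iff _ _).1 hU
  refine ⟨{y | ∀ K ∈ s, dualMackeySeminorm 𝕜 X (K' K) (y - x) < r}, ?_, fun t y hy => ?_⟩
  · rw [mem_nhds_dualMackeyTopology_iff]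
    exact ⟨s.image K', r, hr, fun z hz K hK => hz _ (Finset.mem_image_of_mem _ hK)⟩
  · refine hsU _ fun K hK => ?_
    rw [sub_zero, ← map_sub]
    exact (hK' K t _).trans_lt (hy K hK)

theorem isEquitight_of_seminorm_le {E I ι : Type*} [NormedAddCommGroup E] [NormedSpace 𝕜 E]
    {p : ι → Seminorm 𝕜 E} {S : I → E →L[𝕜] E}
    (hS : ∀ i, ∃ j, ∀ t x, p i (S t x) ≤ p j x) : IsEquitight p S := by
  intro ε hε i
  obtain ⟨j, hj⟩ := hS i
  refine ⟨j, 1, zero_le_one, fun t x => (hj t x).trans ?_⟩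
  rw [one_mul]
  exact le_add_of_nonneg_right (by positivity)

theorem IsBiContinuousSemigroup.isQuasiEquicontinuous [CompleteSpace X]
    (hX : SeqMackeyDualIsEvaluation 𝕜 X) {T : ℝ≥0 → StrongDual 𝕜 X →L[𝕜] StrongDual 𝕜 X}
    (hT : IsBiContinuousSemigroup T (dualMackeyTopology 𝕜 X)) :
    IsQuasiEquicontinuous T (dualMackeyTopology 𝕜 X) :=
  (hT.exists_dualMackeySeminorm_rescale_le hX).imp fun _ h =>
    isTauEquicontinuous_of_dualMackeySeminorm_le h

theorem IsBiContinuousSemigroup.isQuasiEquitight [CompleteSpace X]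
    (hX : SeqMackeyDualIsEvaluation 𝕜 X) {T : ℝ≥0 → StrongDual 𝕜 X →L[𝕜] StrongDual 𝕜 X}
    (hT : IsBiContinuousSemigroup T (dualMackeyTopology 𝕜 X)) :
    IsQuasiEquitight (dualMackeySeminorm 𝕜 X) T :=
  (hT.exists_dualMackeySeminorm_rescale_le hX).imp fun _ h => isEquitight_of_seminorm_le h

end Semigroup

theorem theorem4p10 {𝕜 X : Type*} [RCLike 𝕜] [NormedAddCommGroup X] [NormedSpace 𝕜 X]
    [CompleteSpace X] (T : ℝ≥0 → StrongDual 𝕜 X →L[𝕜] StrongDual 𝕜 X)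
    (hT : IsBiContinuousSemigroup T (dualMackeyTopology 𝕜 X)) :
    -- (a)
    (IsSWCG 𝕜 X ∨ (IsWeaklySeqComplete 𝕜 X ∧ HasAlmostShrinkingBasis 𝕜 X) →
      IsQuasiEquicontinuous T (dualMackeyTopology 𝕜 X)) ∧
    -- (b)
    (IsSWCG 𝕜 X → IsSchurSpace 𝕜 X →
      IsQuasiEquicontinuous T (dualMackeyTopology 𝕜 X) ∧
        IsQuasiEquitight (dualMackeySeminorm 𝕜 X) T) ∧
    -- (b), the special case of separable Schur spaces
    (TopologicalSpace.SeparableSpace X → IsSchurSpace 𝕜 X →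
      IsSWCG 𝕜 X ∧ IsQuasiEquicontinuous T (dualMackeyTopology 𝕜 X) ∧
        IsQuasiEquitight (dualMackeySeminorm 𝕜 X) T) := by
  refine ⟨?_, fun h _ => ?_, fun hsep hS => ?_⟩
  · rintro (h | ⟨hw, hb⟩)
    · exact hT.isQuasiEquicontinuous h.seqMackeyDualIsEvaluation
    · exact hT.isQuasiEquicontinuous (seqMackeyDualIsEvaluation_of_almostShrinking hw hb)
  · exact ⟨hT.isQuasiEquicontinuous h.seqMackeyDualIsEvaluation,
      hT.isQuasiEquitight h.seqMackeyDualIsEvaluation⟩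
  · have h : IsSWCG 𝕜 X := hS.isSWCG
    exact ⟨h, hT.isQuasiEquicontinuous h.seqMackeyDualIsEvaluation,
      hT.isQuasiEquitight h.seqMackeyDualIsEvaluation⟩
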